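/- Let $\mathbb H$ be the real quaternions and, for $n\ge 1$, let $\mathrm{Herm}(n,\mathbb H)$ and $\mathrm{AHerm}(n,\mathbb H)$ be the real vector spaces of $n\times n$ quaternionic matrices $M$ with $M^\dagger=M$ and $M^\dagger=-M$, respectively, where $M^\dagger$ is the conjugate transpose. Call an $\mathbb R$-linear map $\Phi\colon \mathrm{Herm}(n,\mathbb H)\to\mathrm{AHerm}(n,\mathbb H)$ commuting if $H\,\Phi(H)=\Phi(H)\,H$ for all $H\in\mathrm{Herm}(n,\mathbb H)$. Write $\operatorname{tr}(H)=\sum_i H_{ii}$. If $n=1$ or $n=2$, then for every commuting $\mathbb R$-linear map $\Phi$ there is an $A\in\mathrm{AHerm}(n,\mathbb H)$ such that $$\Phi(H)=AH+HA-\operatorname{tr}(H)A\qquad\text{for all } H\in\mathrm{Herm}(n,\mathbb H).$$ Conversely, if $n=1$ or $n=2$, then for every $A\in\mathrm{AHerm}(n,\mathbb H)$ this formula defines an $\mathbb R$-linear map $\mathrm{Herm}(n,\mathbb H)\to\mathrm{AHerm}(n,\mathbb H)$, and this map is commuting. If $n>2$, then the only commuting $\mathbb R$-linear map $\Phi\colon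 \mathrm{Herm}(n,\mathbb H)\to\mathrm{AHerm}(n,\mathbb H)$ is $\Phi=0$. -/

import Mathlib

open scoped Quaternion

/-- The real vector space of self-adjoint `n × n` quaternionic matrices. -/
def QHerm (n : ℕ) : Submodule ℝ (Matrix (Fin n) (Fin n) ℍ[ℝ]) where
  carrier := {M | M.conjTranspose = M}
  zero_mem' := Matrix.conjTranspose_zero
  add_mem' := by
    intro M N hM hN
    simp only [Set.mem_ofPred_eq] at hM hN ⊢
    rw [Matrix.conjTranspose_add, hM, hN]
  smul_mem' := by
    intro c M hM
    simp only [Set.mem_ofPred_eq] at hM ⊢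
    conv_rhs => rw [← hM]
    ext i j <;> simp [Matrix.conjTranspose_apply]

/-- The real vector space of skew-adjoint `n × n` quaternionic matrices. -/
def QAHerm (n : ℕ) : Submodule ℝ (Matrix (Fin n) (Fin n) ℍ[ℝ]) where
  carrier := {M | M.conjTranspose = -M}
  zero_mem' := by simp
  add_mem' := by
    intro M N hM hN
    simp only [Set.mem_ofPred_eq] at hM hN ⊢
    rw [Matrix.conjTranspose_add, hM, hN, neg_add]
  smul_mem' := by
    intro c M hM
    simp only [Set.mem_ofPred_eq] at hM ⊢
    rw [← smul_neg, ← hM]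
    ext i j <;> simp [Matrix.conjTranspose_apply]

/-- A real-linear map from self-adjoint to skew-adjoint matrices is commuting if every `H`
commutes with its image. -/
def IsCommutingMap {n : ℕ} (Φ : QHerm n →ₗ[ℝ] QAHerm n) : Prop :=
  ∀ H : QHerm n,
    (H : Matrix (Fin n) (Fin n) ℍ[ℝ]) * (Φ H : Matrix (Fin n) (Fin n) ℍ[ℝ]) =
      (Φ H : Matrix (Fin n) (Fin n) ℍ[ℝ]) * (H : Matrix (Fin n) (Fin n) ℍ[ℝ])

/-- `Φ(H) = A H + H A - tr(H) A` for all self-adjoint `H`. The scalar `tr(H)` is a quaternion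
acting by left multiplication on the entries of `A`; it is real because `H` is self-adjoint. -/
def HasAnticommutatorForm {n : ℕ} (Φ : QHerm n →ₗ[ℝ] QAHerm n) (A : QAHerm n) : Prop :=
  ∀ H : QHerm n,
    (Φ H : Matrix (Fin n) (Fin n) ℍ[ℝ]) =
      (A : Matrix (Fin n) (Fin n) ℍ[ℝ]) * (H : Matrix (Fin n) (Fin n) ℍ[ℝ]) +
        (H : Matrix (Fin n) (Fin n) ℍ[ℝ]) * (A : Matrix (Fin n) (Fin n) ℍ[ℝ]) -
        (H : Matrix (Fin n) (Fin n) ℍ[ℝ]).trace • (A : Matrix (Fin n) (Fin n) ℍ[ℝ])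

/-!
Polarizing `[H, Φ(H)] = 0` gives `[H, Φ(K)] = [Φ(H), K]`. Taking for `H` the diagonal units `E_kk`
shows that `Φ` is determined by the diagonal entries of `Φ(E_kk)` and of `Φ(q E_ij + q* E_ji)`.
If there is a third index, it forces these entries to be central, hence zero because no nonzero skew
quaternion is central.

For `n = 2` the diagonal entries `E(q)`, `F(q)` of `Φ(q E_12 + q* E_21)` satisfy `q F(q) = E(q) q`.
Then `L(q) = E(q) - q E(1)` commutes with `q` for every `q`, so `L(q)` is a fixed scalar multiple of
`q` up to a scalar, and this gives `E(q) = β q* - q β*`. A skew matrix `A` with off-diagonal entry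
`β` reproduces all the entries that determine `Φ`.

Conversely `[H, A H + H A - tr(H) A] = [H² - tr(H) H, A]`, and for `n ≤ 2` the matrix
`H² - tr(H) H` is a central scalar, as in the Cayley–Hamilton theorem.
-/

open Matrix

theorem lie_map_eq_map_lie_of_commute {A B : Type*} [NonUnitalNonAssocRing A] [AddZeroClass B]
    {f g : B →+ A} (h : ∀ x, Commute (f x) (g x)) (x y : B) : ⁅f x, g y⁆ = ⁅g x, f y⁆ := by
  have hadd := h (x + y)
  simp only [map_add, commute_iff_eq, add_mul, mul_add, (h x).eq, (h y).eq] at hadd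
  rw [Ring.lie_def, Ring.lie_def, sub_eq_sub_iff_add_eq_add]
  refine add_left_cancel (a := g x * f x + g y * f y) ?_
  convert hadd using 1 <;> abel

section PointwiseCommuting

variable {A : Type*} [NonUnitalNonAssocRing A] [StarAddMonoid A]

/-- The notion of `IsCommutingMap` in a general star ring: a map from self-adjoint to skew-adjoint
elements each of whose values commutes with its argument. -/
def IsPointwiseCommuting (Φ : selfAdjoint A → skewAdjoint A) : Prop :=
  ∀ H : selfAdjoint A, Commute (H : A) (Φ H)

theorem IsPointwiseCommuting.sub {Φ Ψ : selfAdjoint A → skewAdjoint A}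
    (hΦ : IsPointwiseCommuting Φ) (hΨ : IsPointwiseCommuting Ψ) :
    IsPointwiseCommuting (Φ - Ψ) :=
  fun H => (hΦ H).sub_right (hΨ H)

theorem IsPointwiseCommuting.lie_map_right {Φ : selfAdjoint A →+ skewAdjoint A}
    (hΦ : IsPointwiseCommuting Φ) (H K : selfAdjoint A) :
    ⁅(H : A), (Φ K : A)⁆ = ⁅(Φ H : A), (K : A)⁆ :=
  lie_map_eq_map_lie_of_commute (f := (selfAdjoint A).subtype)
    (g := (skewAdjoint A).subtype.comp Φ) hΦ H K

end PointwiseCommuting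

section MatrixUnits

variable {ι : Type*} (D : Type*) [DecidableEq ι] [Ring D] [StarRing D]

/-- The diagonal matrix unit `E_ii` as a self-adjoint matrix. -/
def diagUnit (i : ι) : selfAdjoint (Matrix ι ι D) :=
  ⟨diagonal (Pi.single i 1), by
    simp [selfAdjoint.mem_iff, star_eq_conjTranspose, diagonal_conjTranspose]⟩

theorem coe_diagUnit (i : ι) : (diagUnit D i : Matrix ι ι D) = diagonal (Pi.single i 1) := rfl

variable {D}

/-- The self-adjoint matrix `q E_ij + star q E_ji`. -/
def symmSingle (i j : ι) (q : D) : selfAdjoint (Matrix ι ι D) :=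
  ⟨single i j q + star (single i j q), .add_star_self _⟩

/-- The skew-adjoint matrix `q E_ij - star q E_ji`. -/
def skewSingle (i j : ι) (q : D) : skewAdjoint (Matrix ι ι D) :=
  ⟨single i j q - star (single i j q), by simp [skewAdjoint.mem_iff]⟩

/-- The diagonal matrix with skew-adjoint entries `d`. -/
def skewDiagonal (d : ι → skewAdjoint D) : skewAdjoint (Matrix ι ι D) :=
  ⟨diagonal fun i => d i, by
    rw [skewAdjoint.mem_iff, star_eq_conjTranspose, diagonal_conjTranspose, diagonal_neg]
    exact congrArg diagonal (funext fun i => (d i).2)⟩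

theorem coe_symmSingle (i j : ι) (q : D) :
    (symmSingle i j q : Matrix ι ι D) = single i j q + single j i (star q) := by
  simp [symmSingle, star_eq_conjTranspose]

theorem coe_skewSingle (i j : ι) (q : D) :
    (skewSingle i j q : Matrix ι ι D) = single i j q - single j i (star q) := by
  simp [skewSingle, star_eq_conjTranspose]

theorem symmSingle_comm (i j : ι) (q : D) : symmSingle i j q = symmSingle j i (star q) := by
  ext1
  simp [coe_symmSingle, add_comm]

theorem symmSingle_add (i j : ι) (p q : D) :
    symmSingle i j (p + q) = symmSingle i j p + symmSingle i j q := by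
  ext1
  simp only [coe_symmSingle, AddSubgroup.coe_add, star_add, single_add, add_add_add_comm]

theorem lie_symmSingle_apply [Fintype ι] {i j : ι} (hij : i ≠ j) (q : D) (M : Matrix ι ι D) :
    ⁅(symmSingle i j q : Matrix ι ι D), M⁆ i j = q * M j j - M i i * q := by
  simp [Ring.lie_def, coe_symmSingle, add_mul, mul_add, hij, hij.symm]

end MatrixUnits

theorem lie_apply_of_isDiag {ι D : Type*} [Fintype ι] [NonUnitalNonAssocRing D] {A : Matrix ι ι D}
    (hA : A.IsDiag) (M : Matrix ι ι D) (i j : ι) :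
    ⁅A, M⁆ i j = A i i * M i j - M i j * A j j := by
  classical
  rw [← hA.diagonal_diag]
  simp [Ring.lie_def]

theorem star_selfAdjoint_apply {ι D : Type*} [AddGroup D] [StarAddMonoid D]
    (H : selfAdjoint (Matrix ι ι D)) (i j : ι) : star (H.1 i j) = H.1 j i :=
  congrFun₂ H.2 j i

theorem star_skewAdjoint_apply {ι D : Type*} [AddCommGroup D] [StarAddMonoid D]
    (A : skewAdjoint (Matrix ι ι D)) (i j : ι) : star (A.1 i j) = -A.1 j i :=
  congrFun₂ A.2 j i

theorem apply_self_mem_skewAdjoint {ι D : Type*} [AddCommGroup D] [StarAddMonoid D]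
    (A : skewAdjoint (Matrix ι ι D)) (i : ι) : A.1 i i ∈ skewAdjoint D :=
  star_skewAdjoint_apply A i i

section NoCentralSkew

variable {D : Type*} [Ring D] [StarRing D]

theorem eq_zero_of_forall_mul_eq_mul
    (hD : Disjoint (skewAdjoint D) (Subring.center D).toAddSubgroup) {u v : D}
    (hu : u ∈ skewAdjoint D) (h : ∀ q, q * u = v * q) : u = 0 ∧ v = 0 := by
  obtain rfl : u = v := by simpa using h 1
  have hzero : u = 0 := AddSubgroup.disjoint_def.mp hD hu (Subring.mem_center_iff.mpr h)
  exact ⟨hzero, hzero⟩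

namespace IsPointwiseCommuting

variable {ι : Type*} [Fintype ι] [DecidableEq ι]
  {Φ : selfAdjoint (Matrix ι ι D) →+ skewAdjoint (Matrix ι ι D)}

theorem isDiag_map_diagUnit (hΦ : IsPointwiseCommuting Φ) (k : ι) :
    (Φ (diagUnit D k) : Matrix ι ι D).IsDiag := by
  intro i j hij
  rcases eq_or_ne k i with rfl | hki
  · simpa [Ring.lie_def, coe_diagUnit, hij] using congrFun₂ (hΦ (diagUnit D k)).lie_eq k j
  rcases eq_or_ne k j with rfl | hkj
  · simpa [Ring.lie_def, coe_diagUnit, hij] using congrFun₂ (hΦ (diagUnit D k)).lie_eq i k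
  · simpa [Ring.lie_def, coe_diagUnit, hij, hki.symm, hkj.symm] using
      congrFun₂ (hΦ.lie_map_right (diagUnit D i) (diagUnit D k)) i j

theorem map_diagUnit_mul_sub (hΦ : IsPointwiseCommuting Φ) (k : ι) (H : selfAdjoint (Matrix ι ι D))
    (i j : ι) :
    (Φ (diagUnit D k)).1 i i * H.1 i j - H.1 i j * (Φ (diagUnit D k)).1 j j =
      (Pi.single k 1 : ι → D) i * (Φ H).1 i j - (Φ H).1 i j * (Pi.single k 1 : ι → D) j := by
  rw [← lie_apply_of_isDiag (hΦ.isDiag_map_diagUnit k), ← hΦ.lie_map_right, coe_diagUnit,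
    lie_apply_of_isDiag (isDiag_diagonal _), diagonal_apply_eq, diagonal_apply_eq]

variable (hD : Disjoint (skewAdjoint D) (Subring.center D).toAddSubgroup)
include hD

theorem map_diagUnit_apply_eq_neg (hΦ : IsPointwiseCommuting Φ) {i j : ι} (hij : i ≠ j) :
    (Φ (diagUnit D i)).1 j j = -(Φ (diagUnit D j)).1 j j := by
  refine eq_neg_of_add_eq_zero_left (eq_zero_of_forall_mul_eq_mul hD
    (v := (Φ (diagUnit D i)).1 i i + (Φ (diagUnit D j)).1 i i) ?_ fun q => ?_).1
  · simp [skewAdjoint.mem_iff, star_skewAdjoint_apply, add_comm]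
  · have hi : (Φ (diagUnit D i)).1 i i * q - q * (Φ (diagUnit D i)).1 j j =
        (Φ (symmSingle i j q)).1 i j := by
      simpa [coe_symmSingle, hij, hij.symm] using hΦ.map_diagUnit_mul_sub i (symmSingle i j q) i j
    have hj : (Φ (diagUnit D j)).1 i i * q - q * (Φ (diagUnit D j)).1 j j =
        -(Φ (symmSingle i j q)).1 i j := by
      simpa [coe_symmSingle, hij, hij.symm] using hΦ.map_diagUnit_mul_sub j (symmSingle i j q) i j
    linear_combination (norm := noncomm_ring) -hi - hj

theorem map_diagUnit_apply_eq_zero (hΦ : IsPointwiseCommuting Φ) {i j k : ι} (hij : i ≠ j)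
    (hki : k ≠ i) (hkj : k ≠ j) : (Φ (diagUnit D k)).1 i i = 0 := by
  refine (eq_zero_of_forall_mul_eq_mul hD (apply_self_mem_skewAdjoint (Φ (diagUnit D k)) j)
    fun q => ?_).2
  have h : (Φ (diagUnit D k)).1 i i * q - q * (Φ (diagUnit D k)).1 j j = 0 := by
    simpa [coe_symmSingle, hij, hij.symm, hki.symm, hkj.symm] using
      hΦ.map_diagUnit_mul_sub k (symmSingle i j q) i j
  exact (sub_eq_zero.mp h).symm

theorem isDiag_map (hΦ : IsPointwiseCommuting Φ) (hdiag : ∀ i, (Φ (diagUnit D i)).1 i i = 0)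
    (H : selfAdjoint (Matrix ι ι D)) : (Φ H : Matrix ι ι D).IsDiag := by
  intro i j hij
  have h := hΦ.map_diagUnit_mul_sub i H i j
  simpa [hΦ.map_diagUnit_apply_eq_neg hD hij, hdiag, hij] using h.symm

theorem eq_zero_of_diag_eq_zero [Nontrivial ι] (hΦ : IsPointwiseCommuting Φ)
    (hdiag : ∀ i, (Φ (diagUnit D i)).1 i i = 0)
    (hoff : ∀ i j, i ≠ j → ∀ q, (Φ (symmSingle i j q)).1 i i = 0) : Φ = 0 := by
  ext H i j
  rcases eq_or_ne i j with rfl | hij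
  · obtain ⟨j, hji⟩ := exists_ne i
    refine (eq_zero_of_forall_mul_eq_mul hD (apply_self_mem_skewAdjoint (Φ H) j) fun q => ?_).2
    have h := congrFun₂ (hΦ.lie_map_right (symmSingle i j q) H) i j
    rw [lie_symmSingle_apply hji.symm, lie_apply_of_isDiag (hΦ.isDiag_map hD hdiag _),
      hoff i j hji.symm, symmSingle_comm, hoff j i hji, zero_mul, mul_zero, sub_zero] at h
    exact sub_eq_zero.mp h
  · exact hΦ.isDiag_map hD hdiag H hij

omit [DecidableEq ι] in
theorem eq_zero_of_two_lt_card (hΦ : IsPointwiseCommuting Φ) (hι : 2 < Fintype.card ι) :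
    Φ = 0 := by
  classical
  have : Nontrivial ι := Fintype.one_lt_card_iff_nontrivial.mp (by omega)
  have exists_third (i j : ι) : ∃ k, k ≠ i ∧ k ≠ j :=
    ENat.exists_ne_ne_of_three_le (by simpa using mod_cast hι) i j
  have hdiag (i : ι) : (Φ (diagUnit D i)).1 i i = 0 := by
    obtain ⟨j, hji⟩ := exists_ne i
    obtain ⟨k, hki, hkj⟩ := exists_third i j
    have h := hΦ.map_diagUnit_apply_eq_neg hD hji
    rwa [hΦ.map_diagUnit_apply_eq_zero hD hki.symm hji hkj.symm, zero_eq_neg] at h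
  refine hΦ.eq_zero_of_diag_eq_zero hD hdiag fun i j _ q => ?_
  obtain ⟨k, hki, hkj⟩ := exists_third i j
  refine (eq_zero_of_forall_mul_eq_mul hD (apply_self_mem_skewAdjoint (Φ (symmSingle i j q)) k)
    fun r => ?_).2
  have h := congrFun₂ (hΦ.lie_map_right (symmSingle i k r) (symmSingle i j q)) i k
  rw [lie_symmSingle_apply hki.symm, lie_apply_of_isDiag (hΦ.isDiag_map hD hdiag _)] at h
  simpa [coe_symmSingle, hki.symm, hkj.symm, sub_eq_zero] using h

end IsPointwiseCommuting

end NoCentralSkew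

theorem eq_or_eq_of_card_le_two {ι : Type*} [Fintype ι] (hι : Fintype.card ι ≤ 2) {i j : ι}
    (hij : i ≠ j) (k : ι) : k = i ∨ k = j := by
  by_contra! hk
  exact hι.not_gt (Fintype.two_lt_card_iff.mpr ⟨k, i, j, hk.1, hk.2, hij⟩)

theorem sum_eq_add_of_card_le_two {ι M : Type*} [Fintype ι] [AddCommMonoid M]
    (hι : Fintype.card ι ≤ 2) {i j : ι} (hij : i ≠ j) (f : ι → M) : ∑ k, f k = f i + f j :=
  Fintype.sum_eq_add i j hij fun k hk =>
    (eq_or_eq_of_card_le_two hι hij k).elim (absurd · hk.1) (absurd · hk.2)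

theorem mul_self_sub_trace_smul_apply_self {ι D : Type*} [Fintype ι] [NonUnitalNonAssocRing D]
    (hι : Fintype.card ι ≤ 2) (M : Matrix ι ι D) {i j : ι} (hij : i ≠ j) :
    (M * M - M.trace • M) i i = M i j * M j i - M j j * M i i := by
  simp only [Matrix.sub_apply, mul_apply, Matrix.smul_apply, smul_eq_mul, trace, diag_apply,
    sum_eq_add_of_card_le_two hι hij, add_mul, add_sub_add_left_eq_sub]

theorem mul_smul_of_commute {ι D : Type*} [Fintype ι] [NonUnitalSemiring D] {c : D}
    (hc : ∀ x, Commute c x) (M N : Matrix ι ι D) : M * c • N = c • (M * N) := by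
  ext i j
  simp only [mul_apply, Matrix.smul_apply, smul_eq_mul, Finset.mul_sum]
  exact Finset.sum_congr rfl fun k _ => (hc _).symm.left_comm _

section CentralSelfAdjoint

variable {ι D : Type*} [Fintype ι] [Ring D] [StarRing D]

/-- The notion of `HasAnticommutatorForm` over a general star ring. -/
def IsAnticommutatorForm (Φ : selfAdjoint (Matrix ι ι D) → skewAdjoint (Matrix ι ι D))
    (A : skewAdjoint (Matrix ι ι D)) : Prop :=
  ∀ H : selfAdjoint (Matrix ι ι D),
    (Φ H : Matrix ι ι D) = A * H + H * A - (H : Matrix ι ι D).trace • (A : Matrix ι ι D)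

theorem IsAnticommutatorForm.map_diagUnit_apply [DecidableEq ι]
    {Φ : selfAdjoint (Matrix ι ι D) → skewAdjoint (Matrix ι ι D)} {A : skewAdjoint (Matrix ι ι D)}
    (h : IsAnticommutatorForm Φ A) (i : ι) : (Φ (diagUnit D i)).1 i i = A.1 i i := by
  rw [h]
  simp [coe_diagUnit, trace_diagonal]

theorem IsAnticommutatorForm.map_symmSingle_apply [DecidableEq ι]
    {Φ : selfAdjoint (Matrix ι ι D) → skewAdjoint (Matrix ι ι D)} {A : skewAdjoint (Matrix ι ι D)}
    (h : IsAnticommutatorForm Φ A) {i j : ι} (hij : i ≠ j) (q : D) :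
    (Φ (symmSingle i j q)).1 i i = A.1 i j * star q + q * A.1 j i := by
  rw [h]
  simp [coe_symmSingle, mul_add, add_mul, hij, hij.symm, trace_single_eq_of_ne]

theorem isSelfAdjoint_trace (H : selfAdjoint (Matrix ι ι D)) : IsSelfAdjoint H.1.trace := by
  rw [IsSelfAdjoint, ← trace_conjTranspose, ← star_eq_conjTranspose, H.2]

variable (hD : selfAdjoint D ≤ (Subring.center D).toAddSubgroup)
include hD

theorem commute_of_isSelfAdjoint {x : D} (hx : IsSelfAdjoint x) (y : D) : Commute x y :=
  (Subring.mem_center_iff.mp (hD hx) y).symm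

theorem commute_trace (H : selfAdjoint (Matrix ι ι D)) (x : D) : Commute H.1.trace x :=
  commute_of_isSelfAdjoint hD (isSelfAdjoint_trace H) x

theorem commute_star_self (x : D) : Commute x (star x) := by
  have h := commute_of_isSelfAdjoint hD (.add_star_self x) x
  exact (by simpa using h.sub_left (.refl x) : Commute (star x) x).symm

theorem mul_self_sub_trace_smul_apply_of_ne (hι : Fintype.card ι ≤ 2)
    (H : selfAdjoint (Matrix ι ι D)) {i j : ι} (hij : i ≠ j) :
    (H.1 * H.1 - H.1.trace • H.1) i j = 0 := by
  have hjj : Commute (H.1 j j) (H.1 i j) :=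
    commute_of_isSelfAdjoint hD (star_selfAdjoint_apply H j j) _
  simp only [Matrix.sub_apply, mul_apply, Matrix.smul_apply, smul_eq_mul, trace, diag_apply,
    sum_eq_add_of_card_le_two hι hij, add_mul, hjj.eq, sub_self]

theorem commute_mul_self_sub_trace_smul (hι : Fintype.card ι ≤ 2)
    (H : selfAdjoint (Matrix ι ι D)) (M : Matrix ι ι D) :
    Commute (H.1 * H.1 - H.1.trace • H.1) M := by
  rcases subsingleton_or_nontrivial ι with _ | _
  · have : H.1 * H.1 - H.1.trace • H.1 = 0 := by
      ext i j
      have : Unique ι := uniqueOfSubsingleton i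
      simp [mul_apply, trace, Subsingleton.elim i default, Subsingleton.elim j default]
    rw [this]
    exact .zero_left M
  · have hdiag : (H.1 * H.1 - H.1.trace • H.1).IsDiag :=
      fun _ _ hij => mul_self_sub_trace_smul_apply_of_ne hD hι H hij
    have hcentral (i : ι) (x : D) : Commute ((H.1 * H.1 - H.1.trace • H.1) i i) x := by
      obtain ⟨j, hji⟩ := exists_ne i
      rw [mul_self_sub_trace_smul_apply_self hι H.1 hji.symm, ← star_selfAdjoint_apply H i j]
      exact (commute_of_isSelfAdjoint hD (.mul_star_self _) x).sub_left
        (.mul_left (commute_of_isSelfAdjoint hD (star_selfAdjoint_apply H j j) x)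
          (commute_of_isSelfAdjoint hD (star_selfAdjoint_apply H i i) x))
    have hscalar {i j : ι} (hij : i ≠ j) :
        (H.1 * H.1 - H.1.trace • H.1) i i = (H.1 * H.1 - H.1.trace • H.1) j j := by
      rw [mul_self_sub_trace_smul_apply_self hι H.1 hij,
        mul_self_sub_trace_smul_apply_self hι H.1 hij.symm, ← star_selfAdjoint_apply H i j,
        (commute_star_self hD _).eq,
        (commute_of_isSelfAdjoint hD (star_selfAdjoint_apply H j j) _).eq]
    rw [commute_iff_lie_eq]
    ext i j
    rw [lie_apply_of_isDiag hdiag, (hcentral i _).eq]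
    rcases eq_or_ne i j with rfl | hij
    · exact sub_self _
    · rw [hscalar hij, sub_self, Matrix.zero_apply]

theorem IsAnticommutatorForm.isPointwiseCommuting (hι : Fintype.card ι ≤ 2)
    {Φ : selfAdjoint (Matrix ι ι D) → skewAdjoint (Matrix ι ι D)}
    {A : skewAdjoint (Matrix ι ι D)} (h : IsAnticommutatorForm Φ A) :
    IsPointwiseCommuting Φ := by
  intro H
  have hX := (commute_mul_self_sub_trace_smul hD hι H A.1).eq
  rw [commute_iff_eq, h H]
  simp only [sub_mul, mul_sub, mul_add, add_mul, smul_mul_assoc,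
    mul_smul_of_commute (commute_trace hD H)] at hX ⊢
  linear_combination (norm := noncomm_ring) hX

end CentralSelfAdjoint

section AnticommutatorMap

variable (R : Type*) {ι D : Type*} [Fintype ι] [CommSemiring R] [Star R] [TrivialStar R] [Ring D]
  [StarRing D] [Algebra R D] [StarModule R D]

/-- The map `H ↦ A H + H A - tr(H) A`, over a star algebra whose self-adjoint elements are central
so that its values are skew-adjoint. -/
def anticommutatorMap (hD : selfAdjoint D ≤ (Subring.center D).toAddSubgroup)
    (A : skewAdjoint (Matrix ι ι D)) :
    selfAdjoint (Matrix ι ι D) →ₗ[R] skewAdjoint (Matrix ι ι D) where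
  toFun H := ⟨A * H + H * A - (H : Matrix ι ι D).trace • (A : Matrix ι ι D), by
    have htrace : star ((H : Matrix ι ι D).trace • (A : Matrix ι ι D)) =
        -((H : Matrix ι ι D).trace • (A : Matrix ι ι D)) := by
      ext i j
      simp [star_apply, star_skewAdjoint_apply, (isSelfAdjoint_trace H).star_eq,
        (commute_trace hD H _).eq]
    simp only [skewAdjoint.mem_iff, star_sub, star_add, star_mul, selfAdjoint.star_val_eq,
      skewAdjoint.star_val_eq, htrace]
    noncomm_ring⟩
  map_add' H K := by
    ext1
    simp only [AddSubgroup.coe_add, trace_add, mul_add, add_mul, add_smul]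
    abel
  map_smul' r H := by
    ext1
    simp [trace_smul, smul_sub, smul_add]

theorem isAnticommutatorForm_anticommutatorMap
    (hD : selfAdjoint D ≤ (Subring.center D).toAddSubgroup) (A : skewAdjoint (Matrix ι ι D)) :
    IsAnticommutatorForm (anticommutatorMap R hD A) A :=
  fun _ => rfl

end AnticommutatorMap

section Quaternion

instance {R : Type*} [CommRing R] [Star R] [TrivialStar R] : StarModule R ℍ[R] :=
  ⟨fun r q => by rw [star_trivial r, Quaternion.star_smul]⟩

variable {R : Type*} [CommRing R] [Invertible (2 : R)]

theorem eq_zero_of_eq_neg {x : R} (hx : x = -x) : x = 0 := by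
  linear_combination ⅟2 * hx - x * invOf_mul_self (2 : R)

theorem eq_coe_re_of_mem_selfAdjoint {q : ℍ[R]} (hq : q ∈ selfAdjoint ℍ[R]) : q = q.re := by
  have h : star q = q := hq
  ext
  · rfl
  · exact eq_zero_of_eq_neg (congrArg (·.imI) h).symm
  · exact eq_zero_of_eq_neg (congrArg (·.imJ) h).symm
  · exact eq_zero_of_eq_neg (congrArg (·.imK) h).symm

theorem selfAdjoint_quaternion_le_center :
    selfAdjoint ℍ[R] ≤ (Subring.center ℍ[R]).toAddSubgroup := by
  intro q hq
  rw [eq_coe_re_of_mem_selfAdjoint hq]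
  exact Subring.mem_center_iff.mpr fun p => (Quaternion.coe_commute q.re p).symm

/-- The quaternion unit `i`. -/
@[simps]
def quaternionI (R : Type*) [CommRing R] : ℍ[R] := ⟨0, 1, 0, 0⟩

/-- The quaternion unit `j`. -/
@[simps]
def quaternionJ (R : Type*) [CommRing R] : ℍ[R] := ⟨0, 0, 1, 0⟩

theorem commute_quaternionI_iff {q : ℍ[R]} :
    Commute (quaternionI R) q ↔ q.imJ = 0 ∧ q.imK = 0 := by
  refine ⟨fun h => ⟨eq_zero_of_eq_neg ?_, eq_zero_of_eq_neg ?_⟩, fun ⟨hJ, hK⟩ => ?_⟩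
  · simpa using congrArg (·.imK) h.eq
  · simpa using (congrArg (·.imJ) h.eq).symm
  · ext <;> simp [hJ, hK]

theorem commute_quaternionJ_iff {q : ℍ[R]} :
    Commute (quaternionJ R) q ↔ q.imI = 0 ∧ q.imK = 0 := by
  refine ⟨fun h => ⟨eq_zero_of_eq_neg ?_, eq_zero_of_eq_neg ?_⟩, fun ⟨hI, hK⟩ => ?_⟩
  · simpa using (congrArg (·.imK) h.eq).symm
  · simpa using congrArg (·.imI) h.eq
  · ext <;> simp [hI, hK]

theorem eq_coe_re_of_commute {q : ℍ[R]} (hI : Commute (quaternionI R) q)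
    (hJ : Commute (quaternionJ R) q) : q = q.re := by
  rw [commute_quaternionI_iff] at hI
  rw [commute_quaternionJ_iff] at hJ
  ext <;> simp [hI, hJ]

theorem re_eq_zero_of_mem_skewAdjoint {q : ℍ[R]} (hq : q ∈ skewAdjoint ℍ[R]) : q.re = 0 :=
  eq_zero_of_eq_neg <| by simpa using congrArg (·.re) (skewAdjoint.mem_iff.mp hq)

theorem disjoint_skewAdjoint_quaternion_center :
    Disjoint (skewAdjoint ℍ[R]) (Subring.center ℍ[R]).toAddSubgroup := by
  refine AddSubgroup.disjoint_def.mpr fun {q} hskew hcenter => ?_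
  have hcomm := Subring.mem_center_iff.mp hcenter
  rw [eq_coe_re_of_commute (hcomm _) (hcomm _), re_eq_zero_of_mem_skewAdjoint hskew,
    Quaternion.coe_zero]

theorem invOf_two_smul_sub_star_of_mem_skewAdjoint {A : Type*} [AddCommGroup A] [StarAddMonoid A]
    [Module R A] {a : A} (ha : a ∈ skewAdjoint A) : (⅟2 : R) • (a - star a) = a := by
  rw [skewAdjoint.mem_iff.mp ha, sub_neg_eq_add, ← two_smul R, invOf_smul_smul]

theorem exists_eq_smul_add_coe_of_commute {L : ℍ[R] →+ ℍ[R]} (hL : ∀ q, Commute q (L q)) :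
    ∃ (c : R) (f : ℍ[R] → R), ∀ q, L q = c • q + f q := by
  have polar := lie_map_eq_map_lie_of_commute (f := .id _) hL
  simp only [AddMonoidHom.id_apply] at polar
  have hcomm {p : ℍ[R]} {r c : R} (hp : L p = r + c • p) (q : ℍ[R]) : Commute p (L q - c • q) := by
    have h := polar p q
    rw [hp, Ring.lie_def, Ring.lie_def, add_mul, mul_add, (Quaternion.coe_commute r q).eq,
      add_sub_add_left_eq_sub, smul_mul_assoc, mul_smul_comm] at h
    rw [commute_iff_eq, mul_sub, sub_mul, smul_mul_assoc, mul_smul_comm]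
    linear_combination (norm := abel) h
  obtain ⟨r, c, hI⟩ : ∃ r c : R, L (quaternionI R) = r + c • quaternionI R := by
    have h := commute_quaternionI_iff.mp (hL (quaternionI R))
    exact ⟨(L (quaternionI R)).re, (L (quaternionI R)).imI, by ext <;> simp [h]⟩
  obtain ⟨s, d, hJ⟩ : ∃ s d : R, L (quaternionJ R) = s + d • quaternionJ R := by
    have h := commute_quaternionJ_iff.mp (hL (quaternionJ R))
    exact ⟨(L (quaternionJ R)).re, (L (quaternionJ R)).imJ, by ext <;> simp [h]⟩
  obtain rfl : d = c := by
    have h := (commute_quaternionI_iff.mp (hcomm hI (quaternionJ R))).1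
    exact sub_eq_zero.mp (by simpa [hJ] using h)
  refine ⟨d, fun q => (L q - d • q).re, fun q => ?_⟩
  rw [← eq_coe_re_of_commute (hcomm hI q) (hcomm hJ q), add_sub_cancel]

theorem exists_eq_mul_star_sub_of_mul_eq_mul {E F : ℍ[R] →+ ℍ[R]} (hE : ∀ q, E q ∈ skewAdjoint ℍ[R])
    (hEF : ∀ q, q * F q = E q * q) :
    ∃ β : ℍ[R], ∀ q, E q = β * star q - q * star β ∧ F q = star q * β - star β * q := by
  have hone : F 1 = E 1 := by simpa using hEF 1
  have hF (q) : F q = E q + E 1 * q - q * E 1 := by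
    have h := hEF (q + 1)
    simp only [map_add, add_mul, mul_add, one_mul, mul_one, hEF q, hone] at h
    linear_combination (norm := noncomm_ring) h
  obtain ⟨c, f, hL⟩ := exists_eq_smul_add_coe_of_commute
    (L := E - (AddMonoidHom.mulRight (E 1))) fun q => by
      have h := hEF q
      rw [hF] at h
      simp only [AddMonoidHom.sub_apply, AddMonoidHom.coe_mulRight, commute_iff_eq]
      linear_combination (norm := noncomm_ring) h
  have hE_eq (q : ℍ[R]) : E q = c • q + f q + q * E 1 := sub_eq_iff_eq_add.mp (hL q)
  have hstar_one : star (E 1) = -E 1 := hE 1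
  have hE_half (q : ℍ[R]) :
      E q = (⅟2 : R) • (c • (q - star q) + (q * E 1 + E 1 * star q)) := by
    rw [← invOf_two_smul_sub_star_of_mem_skewAdjoint (R := R) (hE q), hE_eq]
    simp only [star_add, Quaternion.star_smul, Quaternion.star_coe, star_mul, hstar_one]
    congr 1
    simp only [neg_mul, smul_sub]
    abel
  refine ⟨(⅟2 : R) • (E 1 - (c : ℍ[R])), fun q => ?_⟩
  simp only [Quaternion.star_smul, star_sub, hstar_one, Quaternion.star_coe, smul_mul_assoc,
    mul_smul_comm, sub_mul, mul_sub, mul_neg, neg_mul, Quaternion.coe_mul_eq_smul,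
    Quaternion.mul_coe_eq_smul]
  constructor
  · rw [hE_half]
    module
  · have htrace : E 1 * q + E 1 * star q = q * E 1 + star q * E 1 := by
      simpa only [mul_add, add_mul] using
        (commute_of_isSelfAdjoint selfAdjoint_quaternion_le_center (.add_star_self q) (E 1)).eq.symm
    rw [hF, add_sub_assoc, ← invOf_smul_smul (2 : R) (E 1 * q - q * E 1), hE_half]
    linear_combination (norm := module) (⅟2 : R) • htrace

end Quaternion

section AnticommutatorForm

variable {ι R : Type*} [Fintype ι] [CommRing R] [Invertible (2 : R)]

theorem exists_isAnticommutatorForm_of_subsingleton [Subsingleton ι] [Star R] [TrivialStar R]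
    (Φ : selfAdjoint (Matrix ι ι ℍ[R]) →ₗ[R] skewAdjoint (Matrix ι ι ℍ[R])) :
    ∃ A, IsAnticommutatorForm Φ A := by
  classical
  refine ⟨Φ 1, fun H => ?_⟩
  ext1 i j
  have : Unique ι := uniqueOfSubsingleton i
  obtain rfl := Subsingleton.elim i j
  obtain ⟨r, hr⟩ : ∃ r : R, H = r • (1 : selfAdjoint (Matrix ι ι ℍ[R])) := by
    refine ⟨(H.1 i i).re, ?_⟩
    ext1
    ext1 k l
    rw [Subsingleton.elim k i, Subsingleton.elim l i]
    exact (eq_coe_re_of_mem_selfAdjoint (star_selfAdjoint_apply H i i)).trans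
      (by simp [← Quaternion.coe_mul_eq_smul])
  simp [hr, trace]

theorem IsPointwiseCommuting.exists_map_symmSingle_apply [DecidableEq ι]
    {Φ : selfAdjoint (Matrix ι ι ℍ[R]) →+ skewAdjoint (Matrix ι ι ℍ[R])}
    (hΦ : IsPointwiseCommuting Φ) {i j : ι} (hij : i ≠ j) :
    ∃ β : ℍ[R], ∀ q, (Φ (symmSingle i j q)).1 i i = β * star q - q * star β ∧
      (Φ (symmSingle i j q)).1 j j = star q * β - star β * q := by
  let entry (k : ι) : ℍ[R] →+ ℍ[R] := AddMonoidHom.mk' (fun q => (Φ (symmSingle i j q)).1 k k)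
    fun p q => by rw [symmSingle_add, map_add, AddSubgroup.coe_add, Matrix.add_apply]
  refine exists_eq_mul_star_sub_of_mul_eq_mul (E := entry i) (F := entry j)
    (fun q => apply_self_mem_skewAdjoint (Φ (symmSingle i j q)) i) fun q => ?_
  rw [← sub_eq_zero]
  exact (lie_symmSingle_apply hij q _).symm.trans (congrFun₂ (hΦ (symmSingle i j q)).lie_eq i j)

theorem IsPointwiseCommuting.exists_isAnticommutatorForm [Nontrivial ι]
    {Φ : selfAdjoint (Matrix ι ι ℍ[R]) →+ skewAdjoint (Matrix ι ι ℍ[R])}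
    (hι : Fintype.card ι ≤ 2) (hΦ : IsPointwiseCommuting Φ) : ∃ A, IsAnticommutatorForm Φ A := by
  classical
  obtain ⟨i, j, hij⟩ := exists_pair_ne ι
  obtain ⟨β, hβ⟩ := hΦ.exists_map_symmSingle_apply hij
  obtain ⟨A, hA_diag, hA_off⟩ : ∃ A : skewAdjoint (Matrix ι ι ℍ[R]),
      (∀ k, A.1 k k = (Φ (diagUnit ℍ[R] k)).1 k k) ∧ A.1 i j = β := by
    refine ⟨skewDiagonal (fun k => ⟨_, apply_self_mem_skewAdjoint (Φ (diagUnit ℍ[R] k)) k⟩) +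
      skewSingle i j β, fun k => ?_, by simp [skewDiagonal, coe_skewSingle, hij, hij.symm]⟩
    rcases eq_or_eq_of_card_le_two hι hij k with rfl | rfl <;>
      simp [skewDiagonal, coe_skewSingle, hij, hij.symm]
  have hA_off' : A.1 j i = -star β := by rw [← hA_off, star_skewAdjoint_apply, neg_neg]
  obtain ⟨Ψ, hΨ⟩ : ∃ Ψ : selfAdjoint (Matrix ι ι ℍ[R]) →+ skewAdjoint (Matrix ι ι ℍ[R]),
      IsAnticommutatorForm Ψ A :=
    ⟨(anticommutatorMap ℤ selfAdjoint_quaternion_le_center A).toAddMonoidHom, fun _ => rfl⟩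
  have hsub : IsPointwiseCommuting (Φ - Ψ : selfAdjoint (Matrix ι ι ℍ[R]) →+ _) :=
    hΦ.sub (hΨ.isPointwiseCommuting selfAdjoint_quaternion_le_center hι)
  suffices Φ - Ψ = 0 from ⟨A, sub_eq_zero.mp this ▸ hΨ⟩
  refine hsub.eq_zero_of_diag_eq_zero disjoint_skewAdjoint_quaternion_center (fun k => ?_)
    fun k l hkl q => ?_
  · exact sub_eq_zero.mpr ((hA_diag k).symm.trans (hΨ.map_diagUnit_apply k).symm)
  · refine sub_eq_zero.mpr (.trans ?_ (hΨ.map_symmSingle_apply hkl q).symm)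
    rcases eq_or_eq_of_card_le_two hι hij k with rfl | rfl <;>
      rcases eq_or_eq_of_card_le_two hι hij l with rfl | rfl
    · exact absurd rfl hkl
    · rw [hA_off, hA_off', (hβ q).1]
      noncomm_ring
    · rw [hA_off, hA_off', symmSingle_comm, (hβ (star q)).2, star_star]
      noncomm_ring
    · exact absurd rfl hkl

end AnticommutatorForm

theorem theorem3_general {ι R : Type*} [Fintype ι] [CommRing R] [Invertible (2 : R)] [Star R]
    [TrivialStar R] :
    (Fintype.card ι ≤ 2 →
      (∀ Φ : selfAdjoint (Matrix ι ι ℍ[R]) →ₗ[R] skewAdjoint (Matrix ι ι ℍ[R]),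
        IsPointwiseCommuting Φ → ∃ A, IsAnticommutatorForm Φ A) ∧
      (∀ A, ∃ Φ : selfAdjoint (Matrix ι ι ℍ[R]) →ₗ[R] skewAdjoint (Matrix ι ι ℍ[R]),
        IsAnticommutatorForm Φ A) ∧
      (∀ (A) (Φ : selfAdjoint (Matrix ι ι ℍ[R]) →ₗ[R] skewAdjoint (Matrix ι ι ℍ[R])),
        IsAnticommutatorForm Φ A → IsPointwiseCommuting Φ)) ∧
    (2 < Fintype.card ι → ∀ Φ : selfAdjoint (Matrix ι ι ℍ[R]) →+ skewAdjoint (Matrix ι ι ℍ[R]),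
      IsPointwiseCommuting Φ → Φ = 0) := by
  refine ⟨fun hι => ⟨fun Φ hΦ => ?_, fun A => ⟨_, isAnticommutatorForm_anticommutatorMap R
    selfAdjoint_quaternion_le_center A⟩, fun A Φ h =>
      h.isPointwiseCommuting selfAdjoint_quaternion_le_center hι⟩,
    fun hι Φ hΦ => hΦ.eq_zero_of_two_lt_card disjoint_skewAdjoint_quaternion_center hι⟩
  rcases subsingleton_or_nontrivial ι with _ | _
  · exact exists_isAnticommutatorForm_of_subsingleton Φ
  · exact hΦ.exists_isAnticommutatorForm (Φ := Φ.toAddMonoidHom) hι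

theorem theorem3 (n : ℕ) :
    ((n = 1 ∨ n = 2) →
      (∀ Φ : QHerm n →ₗ[ℝ] QAHerm n, IsCommutingMap Φ →
        ∃ A : QAHerm n, HasAnticommutatorForm Φ A) ∧
      (∀ A : QAHerm n, ∃ Φ : QHerm n →ₗ[ℝ] QAHerm n, HasAnticommutatorForm Φ A) ∧
      (∀ (A : QAHerm n) (Φ : QHerm n →ₗ[ℝ] QAHerm n),
        HasAnticommutatorForm Φ A → IsCommutingMap Φ)) ∧
    (2 < n → ∀ Φ : QHerm n →ₗ[ℝ] QAHerm n, IsCommutingMap Φ → Φ = 0) := by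
  have h := theorem3_general (ι := Fin n) (R := ℝ)
  rw [Fintype.card_fin] at h
  exact ⟨fun hn => h.1 (by lia), fun hn Φ hΦ =>
    LinearMap.toAddMonoidHom_injective (h.2 hn Φ.toAddMonoidHom hΦ)⟩
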